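/- **Setting.** Let $\nu\neq 0$ be a $\sigma$-finite measure on a measurable space $\mathscr Y$, let $K\ge 2$, $L\ge 2$ and $\mu=\nu^{\otimes L}$. For $k=1,\dots,K$ let $\overline\Theta_k\subset\mathbb R^{e_k}$ be non-empty, let $\eta_k:\overline\Theta_k\to\mathbb R^{d_k}$, and let $T_k:\mathscr Y\to\mathbb R^{d_k}$, $B_k:\mathscr Y\to\mathbb R$ be measurable with $\int e^{\langle\eta_k(\theta),T_k\rangle+B_k}\,d\nu<\infty$ for all $\theta\in\overline\Theta_k$. Put $$A_k(\theta)=-\log\int e^{\langle\eta_k(\theta),T_k(x)\rangle+B_k(x)}\,\nu(dx),\qquad f_{k,\theta}(x)=e^{\langle\eta_k(\theta),T_k(x)\rangle+A_k(\theta)+B_k(x)},\qquad F_{k,\theta}=f_{k,\theta}\cdot\nu .$$ The squared Hellinger distance is $h^2(P,P')=\frac12\int(\sqrt{dP/d\lambda}-\sqrt{dP'/d\lambda})^2d\lambda$, for any measure $\lambda$ dominating $P$ and $P'$. **Parameters.** Let $O_K=\{a\in(0,1)^{K-1}:a_1+\dots+a_{K-1}<1\}$, and let $\overline\Phi$ be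 an open convex subset of the Euclidean space $\mathbb R^{(K-1)(K+1)+e_1+\dots+e_K}$ that is contained in $O_K^{K+1}\times\overline\Theta_1\times\dots\times\overline\Theta_K$. A parameter $\phi=(\phi_w,\phi_{Q,1},\dots,\phi_{Q,K},\theta_1,\dots,\theta_K)\in\overline\Phi$ determines the probability vector $w$ with $(w_1,\dots,w_{K-1})=\phi_w$, and the stochastic matrix $Q$ whose row $k$ satisfies $(Q_{k,1},\dots,Q_{k,K-1})=\phi_{Q,k}$ (the last entries being fixed by the sums being $1$). Let $P_\phi=p(\cdot;\phi)\cdot\mu$ with $$p(\mathbf x;\phi)=\sum_{1\le k_1,\dots,k_L\le K}w_{k_1}Q_{k_1,k_2}\cdots Q_{k_{L-1},k_L}\prod_{l=1}^L f_{k_l,\theta_{k_l}}(x_l),\qquad \mathbf x\in\mathscr Y^L .$$ **Assumption.** For every $k$: (i) $\theta\mapsto F_{k,\theta}$ is continuous on $\overline\Theta_k$ for the Hellinger distance; (ii) $\eta_k$ and $A_k$ are of class $\mathcal C^1$ on $\overline\Theta_k$; (iii) for every $\theta\in\overline\Theta_k$, $\int\|T_k\|^2f_{k,\theta}\,d\nu<\infty$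 and $\int\|T_k\|^2|f_{k,\theta}-f_{k,\theta'}|\,d\nu\to0$ as $\theta'\to\theta$ in $\overline\Theta_k$. **Proposition.** Under this assumption the information matrix $$I(\phi)_{ij}=\int_{\mathscr Y^L}\partial_{\phi_i}p(\mathbf x;\phi)\,\partial_{\phi_j}p(\mathbf x;\phi)\,\frac{\mu(d\mathbf x)}{p(\mathbf x;\phi)}$$ is well defined on $\overline\Phi$ (for every $\phi\in\overline\Phi$ and every $\mathbf x$, $p(\mathbf x;\cdot)$ is positive and differentiable at $\phi$, and the integrands are $\mu$-integrable) and $\phi\mapsto I(\phi)$ is continuous on $\overline\Phi$. Let $\Phi^*$ be the set of all $\phi^*\in\overline\Phi$ such that $I(\phi^*)$ is positive definite and $$\inf\{h^2(P_{\phi^*},P_\phi):\phi\in\overline\Phi,\ \|\phi^*-\phi\|\ge a\}>0\quad\text{for all }a>0\qquad(\inf\emptyset=+\infty).$$ Then for every $\phi^*\in\Phi^*$ there is a constant $C(\phi^*)>0$ such that for all $\phi\in\overline\Phi$ $$C(\phi^*)\Big[\|w^*-w\|_2^2+\|Q^*-Q\|_2^2+\sum_{k=1}^K\big(\|\theta_k^*-\theta_k\|_2^2\wedge1\big)\Big]\le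 h^2(P_{\phi^*},P_\phi),$$ where $(w^*,Q^*,\theta^*)$ and $(w,Q,\theta)$ correspond to $\phi^*$ and $\phi$, and $\|Q^*-Q\|_2$ is the Euclidean norm of the matrix entries. -/

import Mathlib

open MeasureTheory Filter Topology Set

noncomputable section

/-- The squared Hellinger distance `h²(P, Q) = (1/2) ∫ (√(dP/dμ) - √(dQ/dμ))² dμ`, computed with the
dominating measure `μ = P + Q`; `hellingerSq_eq_of_dominated` shows that any other dominating
measure gives the same value. -/
def hellingerSq {X : Type*} [MeasurableSpace X] (P Q : Measure X) : ℝ :=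
  (1 / 2) * ∫ x, (Real.sqrt (P.rnDeriv (P + Q) x).toReal
    - Real.sqrt (Q.rnDeriv (P + Q) x).toReal) ^ 2 ∂(P + Q)

theorem hellingerSq_eq_of_dominated {X : Type*} [MeasurableSpace X] (P Q μ : Measure X)
    [IsFiniteMeasure P] [IsFiniteMeasure Q] [SigmaFinite μ] (hP : P ≪ μ) (hQ : Q ≪ μ) :
    hellingerSq P Q = (1 / 2) * ∫ x, (Real.sqrt (P.rnDeriv μ x).toReal
      - Real.sqrt (Q.rnDeriv μ x).toReal) ^ 2 ∂μ := by
  have hS : P + Q ≪ μ := Measure.AbsolutelyContinuous.add_left hP hQ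
  unfold hellingerSq
  rw [← integral_rnDeriv_smul hS]
  congr 1
  have h1 := Measure.rnDeriv_mul_rnDeriv (κ := μ)
    (show P ≪ P + Q from Measure.AbsolutelyContinuous.rfl.add_right Q)
  have h2 := Measure.rnDeriv_mul_rnDeriv (κ := μ)
    (show Q ≪ P + Q from (Measure.AbsolutelyContinuous.rfl.add_right P).trans
      (by rw [add_comm]))
  refine integral_congr_ae ?_
  filter_upwards [h1, h2] with x hx1 hx2
  rw [← hx1, ← hx2]
  simp only [Pi.mul_apply, ENNReal.toReal_mul, smul_eq_mul]
  set s := ((P + Q).rnDeriv μ x).toReal with hs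
  have hs0 : 0 ≤ s := ENNReal.toReal_nonneg
  rw [Real.sqrt_mul ENNReal.toReal_nonneg, Real.sqrt_mul ENNReal.toReal_nonneg, ← sub_mul, mul_pow,
    Real.sq_sqrt hs0]
  ring

/-- The Hellinger distance. -/
def hellingerDist {X : Type*} [MeasurableSpace X] (P Q : Measure X) : ℝ :=
  Real.sqrt (hellingerSq P Q)

/-- The data `(Θ, η, T, d, B)` of an exponential family with respect to `ν`, with parameter set
`Θ ⊆ ℝᵉ`. Only the values of `η` on `Θ` are meaningful. -/
structure ExpFamily {Y : Type*} [MeasurableSpace Y] (ν : Measure Y) (e d : ℕ) where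
  Θ : Set (EuclideanSpace ℝ (Fin e))
  η : EuclideanSpace ℝ (Fin e) → EuclideanSpace ℝ (Fin d)
  T : Y → EuclideanSpace ℝ (Fin d)
  B : Y → ℝ
  nonempty : Θ.Nonempty
  measurable_T : Measurable T
  measurable_B : Measurable B
  integrable_exp : ∀ θ ∈ Θ, Integrable (fun x => Real.exp (inner ℝ (η θ) (T x) + B x)) ν

namespace ExpFamily

variable {Y : Type*} [MeasurableSpace Y] {ν : Measure Y} {e d : ℕ}

/-- The log-normalization `A(θ) = - log ∫ exp(⟨η(θ), T(x)⟩ + B(x)) ν(dx)`. -/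
def A (E : ExpFamily ν e d) (θ : EuclideanSpace ℝ (Fin e)) : ℝ :=
  - Real.log (∫ x, Real.exp (inner ℝ (E.η θ) (E.T x) + E.B x) ∂ν)

/-- The density `f_θ(x) = exp(⟨η(θ), T(x)⟩ + A(θ) + B(x))`. -/
def density (E : ExpFamily ν e d) (θ : EuclideanSpace ℝ (Fin e)) (x : Y) : ℝ :=
  Real.exp (inner ℝ (E.η θ) (E.T x) + E.A θ + E.B x)

/-- The distribution `F_θ = f_θ · ν`. -/
def dist (E : ExpFamily ν e d) (θ : EuclideanSpace ℝ (Fin e)) : Measure Y :=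
  ν.withDensity (fun x => ENNReal.ofReal (E.density θ x))

/-- The regularity assumption on an emission family. -/
structure Regular (E : ExpFamily ν e d) : Prop where
  hellinger_continuous : ∀ θ ∈ E.Θ,
    Tendsto (fun θ' => hellingerDist (E.dist θ) (E.dist θ')) (𝓝[E.Θ] θ) (𝓝 0)
  contDiffOn_η : ContDiffOn ℝ 1 E.η E.Θ
  contDiffOn_A : ContDiffOn ℝ 1 E.A E.Θ
  integrable_sq : ∀ θ ∈ E.Θ, Integrable (fun x => ‖E.T x‖ ^ 2 * E.density θ x) ν
  tendsto_sq : ∀ θ ∈ E.Θ,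
    Tendsto (fun θ' => ∫ x, ‖E.T x‖ ^ 2 * |E.density θ x - E.density θ' x| ∂ν)
      (𝓝[E.Θ] θ) (𝓝 0)

end ExpFamily

namespace HMM

/-- The open set `O_K`, with `K = m + 1`. -/
def O (m : ℕ) : Set (Fin m → ℝ) :=
  {a | (∀ j, a j ∈ Ioo (0 : ℝ) 1) ∧ ∑ j, a j < 1}

/-- The probability vector `(a_1, …, a_m, 1 - a_1 - ⋯ - a_m)`. -/
def complete {m : ℕ} (a : Fin m → ℝ) : Fin (m + 1) → ℝ :=
  Fin.snoc (α := fun _ => ℝ) a (1 - ∑ j, a j)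

/-- Indices of the coordinates of `φ = (φ_w, φ_{Q,1}, …, φ_{Q,K}, φ_θ)`, with `K = m + 1`. -/
abbrev Idx (m : ℕ) (e : Fin (m + 1) → ℕ) : Type :=
  Fin m ⊕ (Fin (m + 1) × Fin m) ⊕ (Σ k : Fin (m + 1), Fin (e k))

/-- The ambient Euclidean space of the parameter `φ`. -/
abbrev Param (m : ℕ) (e : Fin (m + 1) → ℕ) : Type := EuclideanSpace ℝ (Idx m e)

variable {m : ℕ} {e d : Fin (m + 1) → ℕ}

def Param.toW (φ : Param m e) : Fin m → ℝ := fun j => φ (Sum.inl j)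

def Param.toQ (φ : Param m e) (k : Fin (m + 1)) : Fin m → ℝ :=
  fun j => φ (Sum.inr (Sum.inl (k, j)))

/-- The emission parameter `θ_k` of state `k`. -/
def Param.θ (φ : Param m e) (k : Fin (m + 1)) : EuclideanSpace ℝ (Fin (e k)) :=
  WithLp.toLp 2 (fun j => φ (Sum.inr (Sum.inr ⟨k, j⟩)))

/-- The initial distribution `w` given by `φ`. -/
def Param.w (φ : Param m e) : Fin (m + 1) → ℝ := complete (Param.toW φ)

/-- The transition matrix `Q` given by `φ`: row `k` is the law of the next state given state `k`. -/
def Param.Q (φ : Param m e) : Matrix (Fin (m + 1)) (Fin (m + 1)) ℝ :=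
  fun k => complete (Param.toQ φ k)

variable {Y : Type*} [MeasurableSpace Y] {ν : Measure Y}

/-- The product `O_K^{K+1} × Θ_1 × ⋯ × Θ_K`. -/
def paramDomain (E : ∀ k, ExpFamily ν (e k) (d k)) : Set (Param m e) :=
  {φ | Param.toW φ ∈ O m ∧ (∀ k, Param.toQ φ k ∈ O m) ∧ ∀ k, Param.θ φ k ∈ (E k).Θ}

/-- The dominating measure `μ = ν^{⊗L}`, with `L = r + 1`. -/
def refMeasure (ν : Measure Y) (r : ℕ) : Measure (Fin (r + 1) → Y) :=
  Measure.pi (fun _ => ν)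

/-- The density `p(x; φ)` of `L = r + 1` consecutive observations. -/
def p (E : ∀ k, ExpFamily ν (e k) (d k)) {r : ℕ} (x : Fin (r + 1) → Y) (φ : Param m e) : ℝ :=
  ∑ k : Fin (r + 1) → Fin (m + 1),
    Param.w φ (k 0) * (∏ l : Fin r, Param.Q φ (k l.castSucc) (k l.succ)) *
      ∏ l, (E (k l)).density (Param.θ φ (k l)) (x l)

/-- The distribution `P_φ = p(·; φ) · μ`. -/
def law (E : ∀ k, ExpFamily ν (e k) (d k)) (r : ℕ) (φ : Param m e) : Measure (Fin (r + 1) → Y) :=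
  (refMeasure ν r).withDensity (fun x => ENNReal.ofReal (p E x φ))

/-- The partial derivative `∂_{φ_i} p(x; φ)`. -/
def partialP (E : ∀ k, ExpFamily ν (e k) (d k)) {r : ℕ} (x : Fin (r + 1) → Y) (φ : Param m e)
    (i : Idx m e) : ℝ :=
  fderiv ℝ (fun φ' => p E x φ') φ (EuclideanSpace.single i 1)

/-- The integrand of the `(i, j)` entry of the information matrix. -/
def infoIntegrand (E : ∀ k, ExpFamily ν (e k) (d k)) {r : ℕ} (φ : Param m e) (i j : Idx m e)
    (x : Fin (r + 1) → Y) : ℝ :=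
  partialP E x φ i * partialP E x φ j / p E x φ

/-- The information matrix `I(φ)` of the model of `L = r + 1` consecutive observations. -/
def infoMatrix (E : ∀ k, ExpFamily ν (e k) (d k)) (r : ℕ) (φ : Param m e) :
    Matrix (Idx m e) (Idx m e) ℝ :=
  Matrix.of fun i j => ∫ x, infoIntegrand (r := r) E φ i j x ∂(refMeasure ν r)

/-- The set `Φ*` of the parameters in `Φ` with positive definite information matrix and with
`inf {h²(P_φ*, P_φ) : φ ∈ Φ, ‖φ* - φ‖ ≥ a} > 0` for all `a > 0` (the infimum over the empty set
being `+∞`). -/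
def goodParams (E : ∀ k, ExpFamily ν (e k) (d k)) (r : ℕ) (Φ : Set (Param m e)) :
    Set (Param m e) :=
  {φs ∈ Φ | (infoMatrix E r φs).PosDef ∧
    ∀ a > 0, ∃ c > 0, ∀ φ ∈ Φ, a ≤ ‖φs - φ‖ → c ≤ hellingerSq (law E r φs) (law E r φ)}

end HMM

end

/-!
The global inequality is a local one combined with the separation condition of `goodParams`. Away
from `φ*` the Hellinger distance is bounded below by that condition, while the loss is bounded
(`HMM.exists_loss_le`). Near `φ*` the loss is `O(‖φ - φ*‖²)` (`HMM.loss_isBigO`), and it remains to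
bound the Hellinger distance from below by a multiple of `‖φ - φ*‖²`
(`HMM.exists_quadratic_le_hellingerSq`). If this failed along a sequence, then after passing to a
subsequence whose directions converge to a unit vector `u`, the difference quotients of `√p` would
tend to `0` in `L²` and pointwise to the derivative of `√p` in the direction `u`. By Fatou's lemma
(`eventually_quadratic_le_lintegral_sq_sub`) the integral of the square of this derivative, which is
a quarter of the quadratic form of `I(φ*)` at `u`, would vanish, contrary to positive definiteness.
No uniform control of the derivatives is needed for this.

For the information matrix, write `p` as the sum over the hidden paths `k` of the positive
functions `HMM.pathDensity E k`. By the Cauchy–Schwarz inequality over `k`, `(∂ᵢp)² / p` is at most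
the sum of `(∂ᵢt_k)² / t_k` over the path densities `t_k`, and the exponential form of `t_k` bounds
`|∂ᵢt_k| / t_k` by an affine function of the `‖T(x_l)‖` whose coefficients are continuous in `φ`.
This gives a majorant `HMM.infoBound` of the integrands. Its integral is an explicit function of the
path weights and the second moments of the sufficient statistics, hence continuous in `φ`, so
Pratt's version of dominated convergence (`tendsto_integral_of_tendsto_integral_bound`) shows that
the information matrix is continuous. All pointwise statements hold at interior points of
`HMM.paramDomain E`, where `C¹` regularity on the sets `Θ_k` becomes `C¹` regularity in `φ` on a
neighbourhood.
-/

noncomputable section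

/-! ### Convergence of integrals -/

/-- Pratt's form of the dominated convergence theorem: the dominating functions may vary, provided
that their integrals converge to the integral of their limit. -/
theorem tendsto_integral_of_tendsto_integral_bound {X ι : Type*} [MeasurableSpace X]
    {μ : Measure X} {l : Filter ι} [l.IsCountablyGenerated] {F G : ι → X → ℝ} {f g : X → ℝ}
    (hFm : ∀ᶠ i in l, AEStronglyMeasurable (F i) μ) (hG : ∀ᶠ i in l, Integrable (G i) μ)
    (hg : Integrable g μ) (hbound : ∀ᶠ i in l, ∀ x, |F i x| ≤ G i x)
    (hF : ∀ x, Tendsto (fun i => F i x) l (𝓝 (f x)))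
    (hGg : ∀ x, Tendsto (fun i => G i x) l (𝓝 (g x)))
    (hint : Tendsto (fun i => ∫ x, G i x ∂μ) l (𝓝 (∫ x, g x ∂μ))) :
    Tendsto (fun i => ∫ x, F i x ∂μ) l (𝓝 (∫ x, f x ∂μ)) := by
  rcases l.eq_or_neBot with rfl | hl
  · exact tendsto_bot
  have hfg : ∀ x, |f x| ≤ g x := fun x =>
    le_of_tendsto_of_tendsto (hF x).abs (hGg x) (hbound.mono fun i hi => hi x)
  have hg0 : ∀ x, 0 ≤ g x := fun x => (abs_nonneg _).trans (hfg x)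
  -- the positive parts of `g - G i` are dominated by `g`
  have hpos : Tendsto (fun i => ∫ x, max (g x - G i x) 0 ∂μ) l (𝓝 (∫ _, (0 : ℝ) ∂μ)) := by
    refine tendsto_integral_filter_of_dominated_convergence g ?_ ?_ hg ?_
    · filter_upwards [hG] with i hi
      exact ((hg.sub hi).pos_part).aestronglyMeasurable
    · filter_upwards [hbound] with i hi
      refine .of_forall fun x => ?_
      have := (abs_nonneg _).trans (hi x)
      rw [Real.norm_of_nonneg (le_max_right _ _)]
      exact max_le (by linarith) (hg0 x)
    · refine .of_forall fun x => ?_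
      simpa using ((tendsto_const_nhds (x := g x)).sub (hGg x)).max
        (tendsto_const_nhds (x := (0 : ℝ)))
  -- truncating `F i` at level `g` changes its integral by at most the integral of `(G i - g)⁺`
  have htr : Tendsto (fun i => ∫ x, max (-g x) (min (g x) (F i x)) ∂μ) l (𝓝 (∫ x, f x ∂μ)) := by
    refine tendsto_integral_filter_of_dominated_convergence g ?_ ?_ hg ?_
    · filter_upwards [hFm] with i hi
      exact hg.aestronglyMeasurable.neg.sup (hg.aestronglyMeasurable.inf hi)
    · refine .of_forall fun i => .of_forall fun x => ?_
      rw [Real.norm_eq_abs, abs_le]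
      exact ⟨le_max_left _ _, max_le (by linarith [hg0 x]) (min_le_left _ _)⟩
    · refine .of_forall fun x => ?_
      have h := (tendsto_const_nhds (x := -g x)).max
        ((tendsto_const_nhds (x := g x)).min (hF x))
      have := abs_le.1 (hfg x)
      rwa [min_eq_right this.2, max_eq_right this.1] at h
  have hdiff : Tendsto (fun i => ∫ x, F i x ∂μ - ∫ x, max (-g x) (min (g x) (F i x)) ∂μ) l
      (𝓝 0) := by
    have hb : Tendsto (fun i => (∫ x, G i x ∂μ - ∫ x, g x ∂μ) + ∫ x, max (g x - G i x) 0 ∂μ) l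
        (𝓝 0) := by
      simpa using (hint.sub_const (∫ x, g x ∂μ)).add hpos
    refine squeeze_zero_norm' ?_ hb
    filter_upwards [hFm, hG, hbound] with i hFi hGi hi
    have hFint : Integrable (F i) μ := hGi.mono' hFi (.of_forall fun x => hi x)
    have htint : Integrable (fun x => max (-g x) (min (g x) (F i x))) μ :=
      hg.neg.sup (hg.inf hFint)
    have hpint : Integrable (fun x => max (g x - G i x) 0) μ := (hg.sub hGi).pos_part
    rw [← integral_sub hFint htint, ← integral_sub hGi hg,
      ← integral_add (f := fun x => G i x - g x) (hGi.sub hg) hpint]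
    refine norm_integral_le_of_norm_le ((hGi.sub hg).add hpint) (.of_forall fun x => ?_)
    have h1 := abs_le.1 (hi x)
    have h2 := hg0 x
    rw [Real.norm_eq_abs, abs_le]
    rcases max_cases (-g x) (min (g x) (F i x)) with h | h <;>
      rcases min_cases (g x) (F i x) with h' | h' <;>
      rcases max_cases (g x - G i x) 0 with h'' | h'' <;> constructor <;> linarith
  simpa using hdiff.add htr

/-! ### A quadratic lower bound -/

/-- If `φ ↦ q φ x` is differentiable at `φ₀` for every `x` and no directional derivative vanishes
almost everywhere, then `∫ (q φ - q φ₀)²` grows at least quadratically near `φ₀`. Otherwise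
the difference quotients along some sequence, whose directions converge by compactness to a unit
vector `u`, tend to `0` in `L²`; by Fatou's lemma the derivative in the direction `u` vanishes. -/
theorem eventually_quadratic_le_lintegral_sq_sub {X V : Type*} [MeasurableSpace X] {μ : Measure X}
    [NormedAddCommGroup V] [NormedSpace ℝ V] [FiniteDimensional ℝ V] {q : V → X → ℝ} {φ₀ : V}
    {D : X → V →L[ℝ] ℝ} (hq : ∀ φ, Measurable (q φ))
    (hD : ∀ x, HasFDerivAt (fun φ => q φ x) (D x) φ₀)
    (hpos : ∀ u, u ≠ 0 → ∫⁻ x, ENNReal.ofReal (D x u ^ 2) ∂μ ≠ 0) :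
    ∃ c : ℝ, 0 < c ∧ ∀ᶠ φ in 𝓝 φ₀,
      ENNReal.ofReal (c * ‖φ - φ₀‖ ^ 2) ≤ ∫⁻ x, ENNReal.ofReal ((q φ x - q φ₀ x) ^ 2) ∂μ := by
  by_contra! hcon
  have hseq : ∀ n : ℕ, ∃ φ, ‖φ - φ₀‖ < 1 / ((n : ℝ) + 1) ∧
      ∫⁻ x, ENNReal.ofReal ((q φ x - q φ₀ x) ^ 2) ∂μ
        < ENNReal.ofReal (1 / ((n : ℝ) + 1) * ‖φ - φ₀‖ ^ 2) := by
    intro n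
    have h := hcon (1 / ((n : ℝ) + 1)) (by positivity)
    obtain ⟨φ, h1, h2⟩ := (h.and_eventually
      (Metric.ball_mem_nhds φ₀ (show (0 : ℝ) < 1 / ((n : ℝ) + 1) by positivity))).exists
    exact ⟨φ, by simpa [dist_eq_norm] using h2, h1⟩
  choose φ hφ1 hφ2 using hseq
  have hne : ∀ n, 0 < ‖φ n - φ₀‖ := by
    intro n
    rw [norm_pos_iff]
    intro h
    have := hφ2 n
    simp [h] at this
  have hsub : Tendsto (fun n => φ n - φ₀) atTop (𝓝 0) :=
    squeeze_zero_norm (fun n => (hφ1 n).le) tendsto_one_div_add_atTop_nhds_zero_nat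
  obtain ⟨u, hu, s, hs, hlim⟩ := (isCompact_sphere (0 : V) 1).tendsto_subseq
    (x := fun n => ‖φ n - φ₀‖⁻¹ • (φ n - φ₀)) (fun n => by
      simp [norm_smul, (hne n).ne'])
  have hu0 : u ≠ 0 := by
    rintro rfl
    simp at hu
  refine hpos u hu0 ?_
  have hquot : ∀ x, Tendsto (fun n => ‖φ (s n) - φ₀‖⁻¹ * (q (φ (s n)) x - q φ₀ x)) atTop
      (𝓝 (D x u)) := by
    intro x
    have := (hasFDerivWithinAt_univ.2 (hD x)).lim (hsub.comp hs.tendsto_atTop)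
      (.of_forall fun _ => mem_univ _) hlim
    simpa using this
  have hfatou : ∫⁻ x, ENNReal.ofReal (D x u ^ 2) ∂μ
      ≤ liminf (fun n => ∫⁻ x, ENNReal.ofReal
          ((‖φ (s n) - φ₀‖⁻¹ * (q (φ (s n)) x - q φ₀ x)) ^ 2) ∂μ) atTop := by
    refine le_trans (lintegral_mono fun x => ?_) (lintegral_liminf_le fun n => ?_)
    · exact (((ENNReal.continuous_ofReal.tendsto _).comp ((hquot x).pow 2)).liminf_eq).ge
    · exact ((((hq _).sub (hq _)).const_mul _).pow_const 2).ennreal_ofReal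
  have hzero : Tendsto (fun n => ∫⁻ x, ENNReal.ofReal
      ((‖φ (s n) - φ₀‖⁻¹ * (q (φ (s n)) x - q φ₀ x)) ^ 2) ∂μ) atTop (𝓝 0) := by
    have hlim0 : Tendsto (fun n => ENNReal.ofReal (1 / ((s n : ℝ) + 1))) atTop (𝓝 0) := by
      have := (ENNReal.continuous_ofReal.tendsto 0).comp
        (tendsto_one_div_add_atTop_nhds_zero_nat.comp hs.tendsto_atTop)
      simpa [Function.comp_def] using this
    refine tendsto_of_tendsto_of_tendsto_of_le_of_le tendsto_const_nhds hlim0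
      (fun _ => zero_le) (fun n => ?_)
    have hN := hne (s n)
    set N := ‖φ (s n) - φ₀‖
    calc ∫⁻ x, ENNReal.ofReal ((N⁻¹ * (q (φ (s n)) x - q φ₀ x)) ^ 2) ∂μ
        = ENNReal.ofReal ((N⁻¹) ^ 2)
            * ∫⁻ x, ENNReal.ofReal ((q (φ (s n)) x - q φ₀ x) ^ 2) ∂μ := by
          rw [← lintegral_const_mul']
          · refine lintegral_congr fun x => ?_
            rw [mul_pow, ENNReal.ofReal_mul (by positivity)]
          · exact ENNReal.ofReal_ne_top
      _ ≤ ENNReal.ofReal ((N⁻¹) ^ 2) * ENNReal.ofReal (1 / ((s n : ℝ) + 1) * N ^ 2) := by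
          gcongr
          exact (hφ2 (s n)).le
      _ = ENNReal.ofReal (1 / ((s n : ℝ) + 1)) := by
          rw [← ENNReal.ofReal_mul (by positivity)]
          congr 1
          field_simp
  rw [hzero.liminf_eq] at hfatou
  exact le_antisymm hfatou zero_le

/-! ### Exponential families -/

namespace ExpFamily

variable {Y : Type*} [MeasurableSpace Y] {ν : Measure Y} {e d : ℕ}

theorem measurable_density (E : ExpFamily ν e d) (θ : EuclideanSpace ℝ (Fin e)) :
    Measurable (E.density θ) :=
  Real.measurable_exp.comp
    (((E.measurable_T.const_inner).add_const _).add E.measurable_B)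

theorem density_pos (E : ExpFamily ν e d) (θ : EuclideanSpace ℝ (Fin e)) (x : Y) :
    0 < E.density θ x :=
  Real.exp_pos _

theorem density_eq_exp_mul (E : ExpFamily ν e d) (θ : EuclideanSpace ℝ (Fin e)) (x : Y) :
    E.density θ x = Real.exp (E.A θ) * Real.exp (inner ℝ (E.η θ) (E.T x) + E.B x) := by
  rw [density, ← Real.exp_add]
  congr 1
  ring

theorem integrable_density (E : ExpFamily ν e d) {θ : EuclideanSpace ℝ (Fin e)} (hθ : θ ∈ E.Θ) :
    Integrable (E.density θ) ν := by
  rw [funext (E.density_eq_exp_mul θ)]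
  exact (E.integrable_exp θ hθ).const_mul _

theorem integral_density (E : ExpFamily ν e d) (hν : ν ≠ 0) {θ : EuclideanSpace ℝ (Fin e)}
    (hθ : θ ∈ E.Θ) : ∫ x, E.density θ x ∂ν = 1 := by
  have : NeZero ν := ⟨hν⟩
  have hpos := integral_exp_pos (E.integrable_exp θ hθ)
  rw [funext (E.density_eq_exp_mul θ), integral_const_mul, A, Real.exp_neg, Real.exp_log hpos]
  exact inv_mul_cancel₀ hpos.ne'

/-- The second moment `∫ ‖T‖² f_θ dν` of the sufficient statistic. -/
def secondMoment (E : ExpFamily ν e d) (θ : EuclideanSpace ℝ (Fin e)) : ℝ :=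
  ∫ x, ‖E.T x‖ ^ 2 * E.density θ x ∂ν

theorem Regular.tendsto_secondMoment {E : ExpFamily ν e d} (hE : E.Regular)
    {θ : EuclideanSpace ℝ (Fin e)} (hθ : θ ∈ E.Θ) :
    Tendsto E.secondMoment (𝓝[E.Θ] θ) (𝓝 (E.secondMoment θ)) := by
  rw [tendsto_iff_dist_tendsto_zero]
  refine squeeze_zero' (.of_forall fun _ => dist_nonneg) ?_ (hE.tendsto_sq θ hθ)
  filter_upwards [self_mem_nhdsWithin] with θ' hθ'
  have h1 := hE.integrable_sq θ hθ
  have h2 := hE.integrable_sq θ' hθ'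
  rw [dist_comm, Real.dist_eq, secondMoment, secondMoment, ← integral_sub h1 h2]
  refine (abs_integral_le_integral_abs).trans_eq (integral_congr_ae (.of_forall fun x => ?_))
  simp only
  rw [← mul_sub, abs_mul, abs_of_nonneg (sq_nonneg ‖E.T x‖)]

end ExpFamily

namespace HMM

variable {m r : ℕ} {e d : Fin (m + 1) → ℕ}

/-! ### Weights and densities of the hidden paths -/

theorem complete_pos {a : Fin m → ℝ} (ha : a ∈ O m) (k : Fin (m + 1)) : 0 < complete a k := by
  refine Fin.lastCases ?_ (fun j => ?_) k
  · simpa [complete] using ha.2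
  · simpa [complete] using (ha.1 j).1

theorem complete_le_one {a : Fin m → ℝ} (ha : a ∈ O m) (k : Fin (m + 1)) : complete a k ≤ 1 := by
  refine Fin.lastCases ?_ (fun j => ?_) k
  · simpa [complete] using Finset.sum_nonneg fun j _ => (ha.1 j).1.le
  · simpa [complete] using (ha.1 j).2.le

theorem contDiff_complete {n : WithTop ℕ∞} (k : Fin (m + 1)) :
    ContDiff ℝ n (fun a : Fin m → ℝ => complete a k) := by
  refine Fin.lastCases ?_ (fun j => ?_) k
  · simp only [complete, Fin.snoc_last]
    fun_prop
  · simp only [complete, Fin.snoc_castSucc]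
    fun_prop

theorem contDiff_apply_param {n : WithTop ℕ∞} (i : Idx m e) :
    ContDiff ℝ n (fun φ : Param m e => φ i) :=
  (EuclideanSpace.proj (𝕜 := ℝ) i).contDiff

theorem contDiff_w {n : WithTop ℕ∞} (k : Fin (m + 1)) :
    ContDiff ℝ n (fun φ : Param m e => Param.w φ k) :=
  (contDiff_complete k).comp (contDiff_pi.2 fun _ => contDiff_apply_param _)

theorem contDiff_Q {n : WithTop ℕ∞} (k l : Fin (m + 1)) :
    ContDiff ℝ n (fun φ : Param m e => Param.Q φ k l) :=
  (contDiff_complete l).comp (contDiff_pi.2 fun _ => contDiff_apply_param _)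

theorem contDiff_θ {n : WithTop ℕ∞} (k : Fin (m + 1)) :
    ContDiff ℝ n (fun φ : Param m e => Param.θ φ k) :=
  contDiff_euclidean.2 fun _ => contDiff_apply_param _

/-- The probability `w_{k_0} Q_{k_0,k_1} ⋯ Q_{k_{r-1},k_r}` of the hidden path `k`. -/
def pathWeight (k : Fin (r + 1) → Fin (m + 1)) (φ : Param m e) : ℝ :=
  Param.w φ (k 0) * ∏ l : Fin r, Param.Q φ (k l.castSucc) (k l.succ)

theorem contDiff_pathWeight {n : WithTop ℕ∞} (k : Fin (r + 1) → Fin (m + 1)) :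
    ContDiff ℝ n (pathWeight (e := e) k) :=
  (contDiff_w _).mul (contDiff_prod fun _ _ => contDiff_Q _ _)

variable {Y : Type*} [MeasurableSpace Y] {ν : Measure Y} {E : ∀ k, ExpFamily ν (e k) (d k)}

theorem pathWeight_pos {φ : Param m e} (hφ : φ ∈ paramDomain E) (k : Fin (r + 1) → Fin (m + 1)) :
    0 < pathWeight k φ :=
  mul_pos (complete_pos hφ.1 _) (Finset.prod_pos fun _ _ => complete_pos (hφ.2.1 _) _)

variable (E) in
/-- The joint density of the hidden path `k` and the observations `x`. -/
def pathDensity (k : Fin (r + 1) → Fin (m + 1)) (x : Fin (r + 1) → Y) (φ : Param m e) : ℝ :=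
  pathWeight k φ * ∏ l, (E (k l)).density (Param.θ φ (k l)) (x l)

theorem p_eq_sum_pathDensity (x : Fin (r + 1) → Y) (φ : Param m e) :
    p E x φ = ∑ k, pathDensity E k x φ :=
  rfl

theorem pathDensity_eq_mul_exp (k : Fin (r + 1) → Fin (m + 1)) (x : Fin (r + 1) → Y)
    (φ : Param m e) :
    pathDensity E k x φ = pathWeight k φ * Real.exp (∑ l,
      (inner ℝ ((E (k l)).η (Param.θ φ (k l))) ((E (k l)).T (x l))
        + (E (k l)).A (Param.θ φ (k l)) + (E (k l)).B (x l))) := by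
  rw [pathDensity, Real.exp_sum]
  rfl

theorem pathDensity_pos {φ : Param m e} (hφ : φ ∈ paramDomain E)
    (k : Fin (r + 1) → Fin (m + 1)) (x : Fin (r + 1) → Y) : 0 < pathDensity E k x φ :=
  mul_pos (pathWeight_pos hφ k) (Finset.prod_pos fun _ _ => ExpFamily.density_pos _ _ _)

theorem p_pos {φ : Param m e} (hφ : φ ∈ paramDomain E) (x : Fin (r + 1) → Y) : 0 < p E x φ :=
  Finset.sum_pos (fun k _ => pathDensity_pos hφ k x) Finset.univ_nonempty

theorem measurable_pathDensity (k : Fin (r + 1) → Fin (m + 1)) (φ : Param m e) :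
    Measurable (fun x => pathDensity E k x φ) :=
  (Finset.measurable_prod _ fun l _ =>
    ((E (k l)).measurable_density _).comp (measurable_pi_apply l)).const_mul _

theorem measurable_p (φ : Param m e) : Measurable (fun x : Fin (r + 1) → Y => p E x φ) :=
  Finset.measurable_sum _ fun k _ => measurable_pathDensity k φ

/-! ### Differentiability in the parameter -/

theorem eventually_mem_paramDomain {φ : Param m e} (hφ : φ ∈ interior (paramDomain E)) :
    ∀ᶠ φ' in 𝓝 φ, φ' ∈ paramDomain E :=
  mem_interior_iff_mem_nhds.1 hφ

theorem contDiffAt_η (hE : ∀ k, (E k).Regular) {φ : Param m e}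
    (hφ : φ ∈ interior (paramDomain E)) (k : Fin (m + 1)) :
    ContDiffAt ℝ 1 (fun φ' : Param m e => (E k).η (Param.θ φ' k)) φ :=
  (((hE k).contDiffOn_η.comp (contDiff_θ k).contDiffOn fun _ h => h.2.2 k :
    ContDiffOn ℝ 1 _ (paramDomain E))).contDiffAt (eventually_mem_paramDomain hφ)

theorem contDiffAt_A (hE : ∀ k, (E k).Regular) {φ : Param m e}
    (hφ : φ ∈ interior (paramDomain E)) (k : Fin (m + 1)) :
    ContDiffAt ℝ 1 (fun φ' : Param m e => (E k).A (Param.θ φ' k)) φ :=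
  (((hE k).contDiffOn_A.comp (contDiff_θ k).contDiffOn fun _ h => h.2.2 k :
    ContDiffOn ℝ 1 _ (paramDomain E))).contDiffAt (eventually_mem_paramDomain hφ)

theorem contDiffAt_pathDensity (hE : ∀ k, (E k).Regular) {φ : Param m e}
    (hφ : φ ∈ interior (paramDomain E)) (k : Fin (r + 1) → Fin (m + 1)) (x : Fin (r + 1) → Y) :
    ContDiffAt ℝ 1 (pathDensity E k x) φ := by
  rw [funext (pathDensity_eq_mul_exp (E := E) k x)]
  refine (contDiff_pathWeight k).contDiffAt.mul (ContDiffAt.exp (ContDiffAt.sum fun l _ => ?_))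
  exact (((contDiffAt_η hE hφ _).inner ℝ contDiffAt_const).add (contDiffAt_A hE hφ _)).add
    contDiffAt_const

theorem contDiffAt_p (hE : ∀ k, (E k).Regular) {φ : Param m e}
    (hφ : φ ∈ interior (paramDomain E)) (x : Fin (r + 1) → Y) :
    ContDiffAt ℝ 1 (fun φ' => p E x φ') φ :=
  ContDiffAt.sum fun k _ => contDiffAt_pathDensity hE hφ k x

theorem fderiv_p (hE : ∀ k, (E k).Regular) {φ : Param m e}
    (hφ : φ ∈ interior (paramDomain E)) (x : Fin (r + 1) → Y) :
    fderiv ℝ (fun φ' => p E x φ') φ = ∑ k, fderiv ℝ (pathDensity E k x) φ :=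
  fderiv_fun_sum fun k _ => (contDiffAt_pathDensity hE hφ k x).differentiableAt one_ne_zero

theorem measurable_fderiv_p (hE : ∀ k, (E k).Regular) {φ : Param m e}
    (hφ : φ ∈ interior (paramDomain E)) (u : Param m e) :
    Measurable (fun x : Fin (r + 1) → Y => fderiv ℝ (fun φ' => p E x φ') φ u) := by
  -- a directional derivative is a limit of measurable difference quotients
  refine measurable_of_tendsto_metrizable
    (f := fun (n : ℕ) x => (n : ℝ) * (p E x (φ + (n : ℝ)⁻¹ • u) - p E x φ))
    (fun n => ((measurable_p _).sub (measurable_p _)).const_mul _) ?_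
  rw [tendsto_pi_nhds]
  intro x
  exact (((contDiffAt_p hE hφ x).differentiableAt one_ne_zero).hasFDerivAt.lim_real _).comp
    tendsto_natCast_atTop_atTop

theorem continuousAt_partialP (hE : ∀ k, (E k).Regular) {φ : Param m e}
    (hφ : φ ∈ interior (paramDomain E)) (x : Fin (r + 1) → Y) (i : Idx m e) :
    ContinuousAt (fun φ' => partialP E x φ' i) φ :=
  ((contDiffAt_p hE hφ x).continuousAt_fderiv one_ne_zero).clm_apply continuousAt_const

/-! ### Bounds on the scores -/

variable (E) in
/-- The part of the bound on the norm of the score of the path `k` that does not depend on the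
observations. -/
def scoreConst (k : Fin (r + 1) → Fin (m + 1)) (φ : Param m e) : ℝ :=
  ‖fderiv ℝ (pathWeight k) φ‖ / pathWeight k φ
    + ∑ l, ‖fderiv ℝ (fun φ' : Param m e => (E (k l)).A (Param.θ φ' (k l))) φ‖

variable (E) in
/-- The coefficient of `‖T_k(x_l)‖` in the bound on the norm of the score of a path in state `k`
at time `l`. -/
def scoreSlope (k : Fin (m + 1)) (φ : Param m e) : ℝ :=
  ‖fderiv ℝ (fun φ' : Param m e => (E k).η (Param.θ φ' k)) φ‖

theorem continuousAt_scoreConst (hE : ∀ k, (E k).Regular) {φ : Param m e}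
    (hφ : φ ∈ interior (paramDomain E)) (k : Fin (r + 1) → Fin (m + 1)) :
    ContinuousAt (scoreConst E k) φ := by
  refine ContinuousAt.add (ContinuousAt.div ?_
    (contDiff_pathWeight (n := 1) k).continuous.continuousAt
    (pathWeight_pos (interior_subset hφ) k).ne') ?_
  · exact ((contDiff_pathWeight k).contDiffAt.continuousAt_fderiv one_ne_zero).norm
  · exact tendsto_finsetSum _ fun l _ =>
      ((contDiffAt_A hE hφ _).continuousAt_fderiv one_ne_zero).norm

theorem continuousAt_scoreSlope (hE : ∀ k, (E k).Regular) {φ : Param m e}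
    (hφ : φ ∈ interior (paramDomain E)) (k : Fin (m + 1)) :
    ContinuousAt (scoreSlope E k) φ :=
  ((contDiffAt_η hE hφ k).continuousAt_fderiv one_ne_zero).norm

theorem norm_fderiv_mul_exp_le {V : Type*} [NormedAddCommGroup V] [NormedSpace ℝ V]
    {c S : V → ℝ} {v : V} (hc : DifferentiableAt ℝ c v) (hS : DifferentiableAt ℝ S v)
    (hpos : 0 < c v) :
    ‖fderiv ℝ (fun v => c v * Real.exp (S v)) v‖
      ≤ c v * Real.exp (S v) * (‖fderiv ℝ c v‖ / c v + ‖fderiv ℝ S v‖) := by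
  have h : HasFDerivAt (fun v => c v * Real.exp (S v)) _ v :=
    hc.hasFDerivAt.mul hS.hasFDerivAt.exp
  rw [h.fderiv]
  refine (norm_add_le _ _).trans_eq ?_
  rw [norm_smul, norm_smul, norm_smul, Real.norm_of_nonneg hpos.le,
    Real.norm_of_nonneg (Real.exp_pos _).le]
  field_simp
  ring

theorem norm_fderiv_inner_const_le {V F : Type*} [NormedAddCommGroup V] [NormedSpace ℝ V]
    [NormedAddCommGroup F] [InnerProductSpace ℝ F] {f : V → F} {v : V}
    (hf : DifferentiableAt ℝ f v) (t : F) :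
    ‖fderiv ℝ (fun v => inner ℝ (f v) t) v‖ ≤ ‖fderiv ℝ f v‖ * ‖t‖ := by
  refine ContinuousLinearMap.opNorm_le_bound _ (by positivity) fun u => ?_
  rw [fderiv_inner_apply ℝ hf (differentiableAt_const t)]
  simp only [fderiv_fun_const, Pi.zero_apply, zero_apply, inner_zero_right, zero_add]
  refine (norm_inner_le_norm _ _).trans ?_
  nlinarith [(fderiv ℝ f v).le_opNorm u, norm_nonneg t]

/-- The score `∂t_k / t_k` of a hidden path is at most affine in the norms `‖T(x_l)‖`. -/
theorem norm_fderiv_pathDensity_le (hE : ∀ k, (E k).Regular) {φ : Param m e}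
    (hφ : φ ∈ interior (paramDomain E)) (k : Fin (r + 1) → Fin (m + 1)) (x : Fin (r + 1) → Y) :
    ‖fderiv ℝ (pathDensity E k x) φ‖ ≤ pathDensity E k x φ *
      (scoreConst E k φ + ∑ l, scoreSlope E (k l) φ * ‖(E (k l)).T (x l)‖) := by
  have hη l := (contDiffAt_η hE hφ (k l)).differentiableAt one_ne_zero
  have hA l := (contDiffAt_A hE hφ (k l)).differentiableAt one_ne_zero
  have hw := ((contDiff_pathWeight (n := 1) (e := e) k).differentiable one_ne_zero) φ
  have hT l : DifferentiableAt ℝ (fun φ' : Param m e =>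
      inner ℝ ((E (k l)).η (Param.θ φ' (k l))) ((E (k l)).T (x l))) φ :=
    (hη l).inner ℝ (differentiableAt_const _)
  have hl l := ((hT l).add (hA l)).add_const ((E (k l)).B (x l))
  have hS := DifferentiableAt.fun_sum (u := Finset.univ) fun l _ => hl l
  rw [funext (pathDensity_eq_mul_exp (E := E) k x)]
  refine (norm_fderiv_mul_exp_le hw hS (pathWeight_pos (interior_subset hφ) k)).trans ?_
  refine mul_le_mul_of_nonneg_left ?_
    (mul_pos (pathWeight_pos (interior_subset hφ) k) (Real.exp_pos _)).le
  rw [scoreConst, add_assoc, ← Finset.sum_add_distrib]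
  refine add_le_add_right ?_ _
  refine (congrArg norm (fderiv_fun_sum fun l _ => hl l)).trans_le
    ((norm_sum_le _ _).trans (Finset.sum_le_sum fun l _ => ?_))
  refine (congrArg norm ((fderiv_add_const _).trans (fderiv_add (hT l) (hA l)))).trans_le
    ((norm_add_le _ _).trans ?_)
  rw [add_comm]
  exact add_le_add_right (norm_fderiv_inner_const_le (hη l) _) _

variable (E) in
/-- A majorant of the integrands of the information matrix: the average over the hidden paths of
a bound on the squared norms of their scores. -/
def infoBound (φ : Param m e) (x : Fin (r + 1) → Y) : ℝ :=
  ∑ k, (2 * scoreConst E k φ ^ 2 * pathDensity E k x φ + 2 * ((r + 1 : ℕ) : ℝ) *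
    ∑ l, scoreSlope E (k l) φ ^ 2 * (pathDensity E k x φ * ‖(E (k l)).T (x l)‖ ^ 2))

theorem sq_partialP_div_p_le (hE : ∀ k, (E k).Regular) {φ : Param m e}
    (hφ : φ ∈ interior (paramDomain E)) (x : Fin (r + 1) → Y) (i : Idx m e) :
    partialP E x φ i ^ 2 / p E x φ ≤ infoBound E φ x := by
  have ht k := pathDensity_pos (interior_subset hφ) k x
  rw [partialP, fderiv_p hE hφ, FunLike.coe_sum, Finset.sum_apply, p_eq_sum_pathDensity]
  -- Cauchy–Schwarz over the hidden paths
  refine (Finset.sq_sum_div_le_sum_sq_div _ _ fun k _ => ht k).trans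
    (Finset.sum_le_sum fun k _ => ?_)
  have h1 : |fderiv ℝ (pathDensity E k x) φ (EuclideanSpace.single i 1)| ≤ pathDensity E k x φ *
      (scoreConst E k φ + ∑ l, scoreSlope E (k l) φ * ‖(E (k l)).T (x l)‖) := by
    refine le_trans ?_ (norm_fderiv_pathDensity_le hE hφ k x)
    simpa using (fderiv ℝ (pathDensity E k x) φ).le_opNorm (EuclideanSpace.single i 1)
  have h2 : (∑ l, scoreSlope E (k l) φ * ‖(E (k l)).T (x l)‖) ^ 2 ≤ ((r + 1 : ℕ) : ℝ) *
      ∑ l, scoreSlope E (k l) φ ^ 2 * ‖(E (k l)).T (x l)‖ ^ 2 := by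
    simpa [mul_pow] using sq_sum_le_card_mul_sum_sq (s := Finset.univ)
      (f := fun l => scoreSlope E (k l) φ * ‖(E (k l)).T (x l)‖)
  have h3 : ∑ l, scoreSlope E (k l) φ ^ 2 * (pathDensity E k x φ * ‖(E (k l)).T (x l)‖ ^ 2)
      = pathDensity E k x φ * ∑ l, scoreSlope E (k l) φ ^ 2 * ‖(E (k l)).T (x l)‖ ^ 2 := by
    rw [Finset.mul_sum]
    exact Finset.sum_congr rfl fun _ _ => by ring
  rw [h3, div_le_iff₀ (ht k), ← sq_abs]
  refine (pow_le_pow_left₀ (abs_nonneg _) h1 2).trans ?_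
  rw [mul_pow]
  refine (mul_le_mul_of_nonneg_left (add_sq_le.trans
    (mul_le_mul_of_nonneg_left (add_le_add_right h2 _) zero_le_two)) (sq_nonneg _)).trans_eq ?_
  ring

theorem abs_infoIntegrand_le (hE : ∀ k, (E k).Regular) {φ : Param m e}
    (hφ : φ ∈ interior (paramDomain E)) (i j : Idx m e) (x : Fin (r + 1) → Y) :
    |infoIntegrand E φ i j x| ≤ infoBound E φ x := by
  have hp := p_pos (interior_subset hφ) x
  have hi := sq_partialP_div_p_le hE hφ x i
  have hj := sq_partialP_div_p_le hE hφ x j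
  rw [infoIntegrand, abs_div, abs_of_pos hp, abs_mul, div_le_iff₀ hp]
  rw [div_le_iff₀ hp] at hi hj
  nlinarith [sq_nonneg (|partialP E x φ i| - |partialP E x φ j|), sq_abs (partialP E x φ i),
    sq_abs (partialP E x φ j)]

/-! ### Integrability and continuity of the information -/

/-- Multiplying a path density by `‖T‖²` at time `l` changes only the `l`-th factor. -/
theorem pathDensity_mul_sq (k : Fin (r + 1) → Fin (m + 1)) (φ : Param m e) (l : Fin (r + 1))
    (x : Fin (r + 1) → Y) :
    pathDensity E k x φ * ‖(E (k l)).T (x l)‖ ^ 2 = pathWeight k φ * ∏ l',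
      (if l' = l then fun y => ‖(E (k l')).T y‖ ^ 2 * (E (k l')).density (Param.θ φ (k l')) y
        else (E (k l')).density (Param.θ φ (k l'))) (x l') := by
  have h : ∀ l', (if l' = l then
        fun y => ‖(E (k l')).T y‖ ^ 2 * (E (k l')).density (Param.θ φ (k l')) y
        else (E (k l')).density (Param.θ φ (k l'))) (x l')
      = (if l' = l then ‖(E (k l')).T (x l')‖ ^ 2 else 1)
        * (E (k l')).density (Param.θ φ (k l')) (x l') := by
    intro l'
    split_ifs <;> simp
  rw [Finset.prod_congr rfl fun l' _ => h l', Finset.prod_mul_distrib, Finset.prod_ite_eq',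
    if_pos (Finset.mem_univ l), pathDensity]
  ring

theorem continuousAt_infoBound (hE : ∀ k, (E k).Regular) {φ : Param m e}
    (hφ : φ ∈ interior (paramDomain E)) (x : Fin (r + 1) → Y) :
    ContinuousAt (fun φ' => infoBound E φ' x) φ := by
  refine tendsto_finsetSum _ fun k _ => ?_
  have hk := (contDiffAt_pathDensity hE hφ k x).continuousAt
  refine ((((continuousAt_scoreConst hE hφ k).pow 2).const_mul 2).mul hk).add
    (Tendsto.const_mul _ (tendsto_finsetSum _ fun l _ => ?_))
  exact ((continuousAt_scoreSlope hE hφ _).pow 2).mul (hk.mul_const _)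

theorem continuousAt_secondMoment (hE : ∀ k, (E k).Regular) {φ : Param m e}
    (hφ : φ ∈ interior (paramDomain E)) (k : Fin (m + 1)) :
    ContinuousAt (fun φ' : Param m e => (E k).secondMoment (Param.θ φ' k)) φ :=
  ((hE k).tendsto_secondMoment ((interior_subset hφ).2.2 k)).comp
    (tendsto_nhdsWithin_iff.2 ⟨(contDiff_θ (n := 1) k).continuous.continuousAt,
      (eventually_mem_paramDomain hφ).mono fun _ h => h.2.2 k⟩)

theorem measurable_infoIntegrand (hE : ∀ k, (E k).Regular) {φ : Param m e}
    (hφ : φ ∈ interior (paramDomain E)) (i j : Idx m e) :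
    Measurable (infoIntegrand (r := r) E φ i j) :=
  ((measurable_fderiv_p hE hφ _).mul (measurable_fderiv_p hE hφ _)).div (measurable_p φ)

section Integral

variable [SigmaFinite ν]

theorem integrable_pathDensity {φ : Param m e} (hφ : φ ∈ paramDomain E)
    (k : Fin (r + 1) → Fin (m + 1)) :
    Integrable (fun x => pathDensity E k x φ) (refMeasure ν r) :=
  (Integrable.fintype_prod fun l => (E (k l)).integrable_density (hφ.2.2 (k l))).const_mul _

theorem integrable_p {φ : Param m e} (hφ : φ ∈ paramDomain E) :
    Integrable (fun x => p E x φ) (refMeasure ν r) :=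
  integrable_finsetSum _ fun k _ => integrable_pathDensity hφ k

theorem integral_pathDensity (hν : ν ≠ 0) {φ : Param m e} (hφ : φ ∈ paramDomain E)
    (k : Fin (r + 1) → Fin (m + 1)) :
    ∫ x, pathDensity E k x φ ∂(refMeasure ν r) = pathWeight k φ := by
  simp only [pathDensity, refMeasure]
  rw [integral_const_mul, integral_fintype_prod_eq_prod
    (f := fun l => (E (k l)).density (Param.θ φ (k l)))]
  simp [fun l => (E (k l)).integral_density hν (hφ.2.2 (k l))]

theorem integrable_pathDensity_mul_sq (hE : ∀ k, (E k).Regular) {φ : Param m e}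
    (hφ : φ ∈ paramDomain E) (k : Fin (r + 1) → Fin (m + 1)) (l : Fin (r + 1)) :
    Integrable (fun x => pathDensity E k x φ * ‖(E (k l)).T (x l)‖ ^ 2) (refMeasure ν r) := by
  rw [funext (pathDensity_mul_sq (E := E) k φ l)]
  refine (Integrable.fintype_prod fun l' => ?_).const_mul _
  split_ifs
  · exact (hE _).integrable_sq _ (hφ.2.2 _)
  · exact (E _).integrable_density (hφ.2.2 _)

theorem integral_pathDensity_mul_sq (hν : ν ≠ 0) {φ : Param m e}
    (hφ : φ ∈ paramDomain E) (k : Fin (r + 1) → Fin (m + 1)) (l : Fin (r + 1)) :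
    ∫ x, pathDensity E k x φ * ‖(E (k l)).T (x l)‖ ^ 2 ∂(refMeasure ν r)
      = pathWeight k φ * (E (k l)).secondMoment (Param.θ φ (k l)) := by
  rw [funext (pathDensity_mul_sq (E := E) k φ l), integral_const_mul, refMeasure,
    integral_fintype_prod_eq_prod, Finset.prod_eq_single l]
  · rw [if_pos rfl, ExpFamily.secondMoment]
  · intro l' _ hl'
    rw [if_neg hl', (E _).integral_density hν (hφ.2.2 _)]
  · simp

theorem integrable_infoBound (hE : ∀ k, (E k).Regular) {φ : Param m e}
    (hφ : φ ∈ paramDomain E) : Integrable (infoBound (r := r) E φ) (refMeasure ν r) :=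
  integrable_finsetSum _ fun k _ => ((integrable_pathDensity hφ k).const_mul _).add
    ((integrable_finsetSum _ fun l _ =>
      (integrable_pathDensity_mul_sq hE hφ k l).const_mul _).const_mul _)

/-- The explicit form of the integral reduces its continuity in `φ` to that of the coefficients
and of the second moments. -/
theorem integral_infoBound (hν : ν ≠ 0) (hE : ∀ k, (E k).Regular) {φ : Param m e}
    (hφ : φ ∈ paramDomain E) :
    ∫ x, infoBound E φ x ∂(refMeasure ν r) = ∑ k : Fin (r + 1) → Fin (m + 1),
      (2 * scoreConst E k φ ^ 2 * pathWeight k φ + 2 * ((r + 1 : ℕ) : ℝ) *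
        ∑ l, scoreSlope E (k l) φ ^ 2 *
          (pathWeight k φ * (E (k l)).secondMoment (Param.θ φ (k l)))) := by
  have h1 k := (integrable_pathDensity (r := r) hφ k).const_mul (2 * scoreConst E k φ ^ 2)
  have h2 k l := (integrable_pathDensity_mul_sq (r := r) hE hφ k l).const_mul
    (scoreSlope E (k l) φ ^ 2)
  have h3 k := (integrable_finsetSum Finset.univ fun l _ => h2 k l).const_mul
    (2 * ((r + 1 : ℕ) : ℝ))
  refine (integral_finsetSum _ fun k _ => (h1 k).add (h3 k)).trans
    (Finset.sum_congr rfl fun k _ => (integral_add (h1 k) (h3 k)).trans ?_)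
  rw [integral_const_mul, integral_const_mul,
    integral_pathDensity hν hφ, integral_finsetSum _ fun l _ => h2 k l]
  congr 2
  refine Finset.sum_congr rfl fun l _ => ?_
  rw [integral_const_mul, integral_pathDensity_mul_sq hν hφ]

theorem tendsto_integral_infoBound (hν : ν ≠ 0) (hE : ∀ k, (E k).Regular) {φ : Param m e}
    (hφ : φ ∈ interior (paramDomain E)) :
    Tendsto (fun φ' => ∫ x, infoBound E φ' x ∂(refMeasure ν r)) (𝓝 φ)
      (𝓝 (∫ x, infoBound E φ x ∂(refMeasure ν r))) := by
  have hw (k : Fin (r + 1) → Fin (m + 1)) : ContinuousAt (pathWeight (e := e) k) φ :=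
    (contDiff_pathWeight (n := 1) k).continuous.continuousAt
  rw [integral_infoBound hν hE (interior_subset hφ)]
  refine Tendsto.congr' ((eventually_mem_paramDomain hφ).mono fun φ' h =>
    (integral_infoBound hν hE h).symm) (tendsto_finsetSum _ fun k _ => ?_)
  refine ((((continuousAt_scoreConst hE hφ k).pow 2).const_mul 2).mul (hw k)).add
    (Tendsto.const_mul _ (tendsto_finsetSum _ fun l _ => ?_))
  exact ((continuousAt_scoreSlope hE hφ _).pow 2).mul
    ((hw k).mul (continuousAt_secondMoment hE hφ _))

theorem integrable_infoIntegrand (hE : ∀ k, (E k).Regular) {φ : Param m e}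
    (hφ : φ ∈ interior (paramDomain E)) (i j : Idx m e) :
    Integrable (infoIntegrand (r := r) E φ i j) (refMeasure ν r) :=
  (integrable_infoBound hE (interior_subset hφ)).mono'
    (measurable_infoIntegrand hE hφ i j).aestronglyMeasurable
    (.of_forall fun x => abs_infoIntegrand_le hE hφ i j x)

theorem continuousAt_infoMatrix (hν : ν ≠ 0) (hE : ∀ k, (E k).Regular) {φ : Param m e}
    (hφ : φ ∈ interior (paramDomain E)) : ContinuousAt (infoMatrix E r) φ := by
  have hint : ∀ᶠ φ' in 𝓝 φ, φ' ∈ interior (paramDomain E) := isOpen_interior.mem_nhds hφ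
  refine tendsto_pi_nhds.2 fun i => tendsto_pi_nhds.2 fun j => ?_
  refine tendsto_integral_of_tendsto_integral_bound (G := infoBound E) (g := infoBound E φ)
    (hint.mono fun φ' h => (measurable_infoIntegrand hE h i j).aestronglyMeasurable)
    (hint.mono fun φ' h => integrable_infoBound hE (interior_subset h))
    (integrable_infoBound hE (interior_subset hφ))
    (hint.mono fun φ' h x => abs_infoIntegrand_le hE h i j x) (fun x => ?_)
    (fun x => continuousAt_infoBound hE hφ x) (tendsto_integral_infoBound hν hE hφ)
  exact ((continuousAt_partialP hE hφ x i).mul (continuousAt_partialP hE hφ x j)).div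
    (contDiffAt_p hE hφ x).continuousAt (p_pos (interior_subset hφ) x).ne'

end Integral

/-! ### The Hellinger distance near and away from a parameter -/

section Hellinger

variable [SigmaFinite ν]

theorem isFiniteMeasure_law {φ : Param m e} (hφ : φ ∈ paramDomain E) :
    IsFiniteMeasure (law E r φ) :=
  isFiniteMeasure_withDensity_ofReal (integrable_p hφ).2

theorem hellingerSq_law {φ φ' : Param m e} (hφ : φ ∈ paramDomain E) (hφ' : φ' ∈ paramDomain E) :
    hellingerSq (law E r φ) (law E r φ')
      = (1 / 2) * ∫ x, (√(p E x φ) - √(p E x φ')) ^ 2 ∂(refMeasure ν r) := by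
  have := isFiniteMeasure_law (r := r) hφ
  have := isFiniteMeasure_law (r := r) hφ'
  have : SigmaFinite (refMeasure ν r) := by unfold refMeasure; infer_instance
  rw [hellingerSq_eq_of_dominated (law E r φ) (law E r φ') (refMeasure ν r)
    (withDensity_absolutelyContinuous _ _) (withDensity_absolutelyContinuous _ _)]
  congr 1
  refine integral_congr_ae ?_
  filter_upwards [Measure.rnDeriv_withDensity (refMeasure ν r)
      (measurable_p (r := r) (E := E) φ).ennreal_ofReal,
    Measure.rnDeriv_withDensity (refMeasure ν r)
      (measurable_p (r := r) (E := E) φ').ennreal_ofReal] with x h1 h2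
  rw [law, law, h1, h2, ENNReal.toReal_ofReal (p_pos hφ x).le,
    ENNReal.toReal_ofReal (p_pos hφ' x).le]

theorem integrable_sq_sqrt_p_sub {φ φ' : Param m e} (hφ : φ ∈ paramDomain E)
    (hφ' : φ' ∈ paramDomain E) :
    Integrable (fun x => (√(p E x φ) - √(p E x φ')) ^ 2) (refMeasure ν r) := by
  refine (((integrable_p hφ).add (integrable_p hφ')).const_mul 2).mono'
    (((measurable_p φ).sqrt.sub (measurable_p φ').sqrt).pow_const 2).aestronglyMeasurable
    (.of_forall fun x => ?_)
  rw [Real.norm_of_nonneg (sq_nonneg _)]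
  simp only [Pi.add_apply]
  nlinarith [Real.sq_sqrt (p_pos hφ x).le, Real.sq_sqrt (p_pos hφ' x).le,
    sq_nonneg (√(p E x φ) + √(p E x φ'))]

theorem lintegral_sq_sqrt_p_sub {φ φ' : Param m e} (hφ : φ ∈ paramDomain E)
    (hφ' : φ' ∈ paramDomain E) :
    ∫⁻ x, ENNReal.ofReal ((√(p E x φ') - √(p E x φ)) ^ 2) ∂(refMeasure ν r)
      = ENNReal.ofReal (2 * hellingerSq (law E r φ) (law E r φ')) := by
  rw [hellingerSq_law hφ hφ', ← ofReal_integral_eq_lintegral_ofReal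
    (integrable_sq_sqrt_p_sub hφ' hφ) (.of_forall fun x => sq_nonneg _)]
  congr 1
  rw [← mul_assoc, mul_one_div_cancel two_ne_zero, one_mul]
  exact integral_congr_ae (.of_forall fun x => by ring)

/-- The quadratic form of the information matrix is the integral of the squared directional
derivatives of `p`, normalized by `p`. -/
theorem dotProduct_infoMatrix_mulVec (hE : ∀ k, (E k).Regular) {φ : Param m e}
    (hφ : φ ∈ interior (paramDomain E)) (u : Param m e) :
    u.ofLp ⬝ᵥ (infoMatrix E r φ).mulVec u.ofLp
      = ∫ x, fderiv ℝ (fun φ' => p E x φ') φ u ^ 2 / p E x φ ∂(refMeasure ν r) := by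
  have hu : ∀ x : Fin (r + 1) → Y, fderiv ℝ (fun φ' => p E x φ') φ u
      = ∑ i, u i * partialP E x φ i := by
    intro x
    conv_lhs => rw [← (EuclideanSpace.basisFun (Idx m e) ℝ).sum_repr u]
    simp [partialP]
  have hint i j := (integrable_infoIntegrand (r := r) hE hφ i j).const_mul (u i * u j)
  simp_rw [dotProduct, Matrix.mulVec, dotProduct, Finset.mul_sum]
  have hx : ∀ x : Fin (r + 1) → Y, fderiv ℝ (fun φ' => p E x φ') φ u ^ 2 / p E x φ
      = ∑ i, ∑ j, (u i * u j) * infoIntegrand E φ i j x := by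
    intro x
    rw [hu, sq, Finset.sum_mul_sum, Finset.sum_div]
    refine Finset.sum_congr rfl fun i _ => ?_
    rw [Finset.sum_div]
    refine Finset.sum_congr rfl fun j _ => ?_
    rw [infoIntegrand]
    ring
  rw [integral_congr_ae (.of_forall hx),
    integral_finsetSum _ fun i _ => integrable_finsetSum _ fun j _ => hint i j]
  refine Finset.sum_congr rfl fun i _ => ?_
  rw [integral_finsetSum _ fun j _ => hint i j]
  refine Finset.sum_congr rfl fun j _ => ?_
  rw [integral_const_mul, infoMatrix, Matrix.of_apply]
  ring

/-- The squared Hellinger distance is half the squared `L²` distance of the functions `√p`, whose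
derivative in a direction `u` has squared `L²` norm `uᵀ I(φ) u / 4`. -/
theorem exists_quadratic_le_hellingerSq (hE : ∀ k, (E k).Regular) {φ : Param m e}
    (hφ : φ ∈ interior (paramDomain E)) (hI : (infoMatrix E r φ).PosDef) :
    ∃ c : ℝ, 0 < c ∧ ∀ᶠ φ' in 𝓝 φ,
      c * ‖φ' - φ‖ ^ 2 ≤ hellingerSq (law E r φ) (law E r φ') := by
  have hp := p_pos (r := r) (interior_subset hφ)
  have hpos : ∀ u, u ≠ 0 → ∫⁻ x, ENNReal.ofReal
      (((1 / (2 * √(p E x φ))) • fderiv ℝ (fun φ' => p E x φ') φ) u ^ 2) ∂(refMeasure ν r) ≠ 0 := by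
    intro u hu h0
    have hquad := hI.dotProduct_mulVec_pos (x := u.ofLp) (by simpa using hu)
    rw [star_trivial, dotProduct_infoMatrix_mulVec hE hφ] at hquad
    refine hquad.ne' (integral_eq_zero_of_ae ?_)
    rw [lintegral_eq_zero_iff] at h0
    · filter_upwards [h0] with x hx
      have hx' := sq_eq_zero_iff.1 (le_antisymm (ENNReal.ofReal_eq_zero.1 hx) (sq_nonneg _))
      have hs := Real.sqrt_pos.2 (hp x)
      have : fderiv ℝ (fun φ' => p E x φ') φ u = 0 := by
        simpa [hs.ne'] using hx'
      simp [this]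
    · exact (((measurable_const.div ((measurable_p φ).sqrt.const_mul 2)).mul
        (measurable_fderiv_p hE hφ u)).pow_const 2).ennreal_ofReal
  obtain ⟨c, hc, h⟩ := eventually_quadratic_le_lintegral_sq_sub (μ := refMeasure ν r)
    (q := fun φ' x => √(p E x φ')) (φ₀ := φ) (fun φ' => (measurable_p φ').sqrt)
    (fun x => (((contDiffAt_p hE hφ x).differentiableAt one_ne_zero).hasFDerivAt).sqrt
      (hp x).ne') hpos
  refine ⟨c / 2, by positivity, ?_⟩
  filter_upwards [h, eventually_mem_paramDomain hφ] with φ' h1 h2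
  rw [lintegral_sq_sqrt_p_sub (interior_subset hφ) h2, ENNReal.ofReal_le_ofReal_iff'] at h1
  have h3 : 0 ≤ hellingerSq (law E r φ) (law E r φ') := by
    rw [hellingerSq_law (interior_subset hφ) h2]
    positivity
  rcases h1 with h1 | h1 <;> linarith

end Hellinger

/-! ### Comparison of parameters -/

/-- The loss between two parameters that is bounded by the Hellinger distance. -/
def loss (φs φ : Param m e) : ℝ :=
  ∑ k, (Param.w φs k - Param.w φ k) ^ 2 + ∑ k, ∑ l, (Param.Q φs k l - Param.Q φ k l) ^ 2
    + ∑ k, min (‖Param.θ φs k - Param.θ φ k‖ ^ 2) 1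

theorem loss_isBigO (φs : Param m e) : loss φs =O[𝓝 φs] fun φ => ‖φ - φs‖ ^ 2 := by
  -- each parameter component is differentiable, hence its increment is `O(‖φ - φs‖)`
  have key : ∀ {F : Type} [NormedAddCommGroup F] [NormedSpace ℝ F] (g : Param m e → F),
      ContDiff ℝ 1 g → (fun φ => ‖g φs - g φ‖ ^ 2) =O[𝓝 φs] fun φ => ‖φ - φs‖ ^ 2 := by
    intro F _ _ g hg
    have h : (fun φ => ‖g φ - g φs‖ ^ 2) =O[𝓝 φs] fun φ => ‖φ - φs‖ ^ 2 :=
      ((hg.differentiable one_ne_zero φs).hasFDerivAt.isBigO_sub).norm_norm.pow 2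
    simpa only [norm_sub_rev (g φs)] using h
  have hw (k) : (fun φ => (Param.w φs k - Param.w φ k) ^ 2) =O[𝓝 φs] fun φ => ‖φ - φs‖ ^ 2 := by
    simpa using key (fun φ => Param.w φ k) (contDiff_w k)
  have hQ (k l) : (fun φ => (Param.Q φs k l - Param.Q φ k l) ^ 2) =O[𝓝 φs]
      fun φ => ‖φ - φs‖ ^ 2 := by
    simpa using key (fun φ => Param.Q φ k l) (contDiff_Q k l)
  have hθ (k) : (fun φ => min (‖Param.θ φs k - Param.θ φ k‖ ^ 2) 1) =O[𝓝 φs]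
      fun φ => ‖φ - φs‖ ^ 2 := by
    refine (Asymptotics.isBigO_of_le _ fun φ => ?_).trans
      (key (fun φ => Param.θ φ k) (contDiff_θ k))
    rw [Real.norm_of_nonneg (by positivity), Real.norm_of_nonneg (by positivity)]
    exact min_le_left _ _
  exact ((Asymptotics.IsBigO.fun_sum fun k _ => hw k).add
    (Asymptotics.IsBigO.fun_sum fun k _ => Asymptotics.IsBigO.fun_sum fun l _ => hQ k l)).add
    (Asymptotics.IsBigO.fun_sum fun k _ => hθ k)

theorem exists_loss_le (E : ∀ k, ExpFamily ν (e k) (d k)) : ∃ M : ℝ, 0 < M ∧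
    ∀ φs ∈ paramDomain E, ∀ φ ∈ paramDomain E, loss φs φ ≤ M := by
  have hsq : ∀ {a b : Fin m → ℝ}, a ∈ O m → b ∈ O m → ∀ k,
      (complete a k - complete b k) ^ 2 ≤ 1 := by
    intro a b ha hb k
    have := complete_pos ha k
    have := complete_pos hb k
    have := complete_le_one ha k
    have := complete_le_one hb k
    rw [sq_le_one_iff_abs_le_one, abs_le]
    constructor <;> linarith
  refine ⟨∑ _k : Fin (m + 1), 1 + ∑ _k : Fin (m + 1), ∑ _l : Fin (m + 1), 1
    + ∑ _k : Fin (m + 1), 1, by simp; positivity, fun φs hs φ hφ => ?_⟩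
  exact add_le_add (add_le_add (Finset.sum_le_sum fun k _ => hsq hs.1 hφ.1 k)
    (Finset.sum_le_sum fun k _ => Finset.sum_le_sum fun l _ => hsq (hs.2.1 k) (hφ.2.1 k) l))
    (Finset.sum_le_sum fun k _ => min_le_right _ _)

end HMM

end

/-- Here `K = m + 1 ≥ 2` is the number of hidden states and `L = r + 1 ≥ 2` the number of
consecutive observations. -/
theorem mainTheorem9 {Y : Type*} [MeasurableSpace Y] (ν : Measure Y) [SigmaFinite ν] (hν : ν ≠ 0)
    (m r : ℕ) (hm : 1 ≤ m) (hr : 1 ≤ r) (e d : Fin (m + 1) → ℕ)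
    (E : ∀ k, ExpFamily ν (e k) (d k)) (hE : ∀ k, (E k).Regular)
    (Φ : Set (HMM.Param m e)) (hΦ_open : IsOpen Φ) (hΦ_convex : Convex ℝ Φ)
    (hΦ_sub : Φ ⊆ HMM.paramDomain E) :
    (∀ φ ∈ Φ, ∀ x : Fin (r + 1) → Y,
      0 < HMM.p E x φ ∧ DifferentiableAt ℝ (fun φ' => HMM.p E x φ') φ) ∧
    (∀ φ ∈ Φ, ∀ i j, Integrable (HMM.infoIntegrand (r := r) E φ i j) (HMM.refMeasure ν r)) ∧
    ContinuousOn (HMM.infoMatrix E r) Φ ∧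
    ∀ φs ∈ HMM.goodParams E r Φ, ∃ C : ℝ, 0 < C ∧ ∀ φ ∈ Φ,
      C * (∑ k, (HMM.Param.w φs k - HMM.Param.w φ k) ^ 2
          + ∑ k, ∑ l, (HMM.Param.Q φs k l - HMM.Param.Q φ k l) ^ 2
          + ∑ k, min (‖HMM.Param.θ φs k - HMM.Param.θ φ k‖ ^ 2) 1)
        ≤ hellingerSq (HMM.law E r φs) (HMM.law E r φ) := by
  have hΦ : Φ ⊆ interior (HMM.paramDomain E) := interior_maximal hΦ_sub hΦ_open
  refine ⟨fun φ hφ x => ⟨HMM.p_pos (hΦ_sub hφ) x,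
      (HMM.contDiffAt_p hE (hΦ hφ) x).differentiableAt one_ne_zero⟩,
    fun φ hφ i j => HMM.integrable_infoIntegrand hE (hΦ hφ) i j,
    fun φ hφ => (HMM.continuousAt_infoMatrix hν hE (hΦ hφ)).continuousWithinAt, ?_⟩
  rintro φs ⟨hφs, hI, hsep⟩
  change ∃ C : ℝ, 0 < C ∧ ∀ φ ∈ Φ, C * HMM.loss φs φ ≤ _
  obtain ⟨c, hc, hnear⟩ := HMM.exists_quadratic_le_hellingerSq hE (hΦ hφs) hI
  obtain ⟨b, hb, hloss⟩ := (HMM.loss_isBigO φs).exists_pos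
  obtain ⟨a, ha, hball⟩ := Metric.eventually_nhds_iff.1 (hnear.and hloss.bound)
  obtain ⟨c', hc', hfar⟩ := hsep a ha
  obtain ⟨M, hM, hle⟩ := HMM.exists_loss_le E
  -- `c / b` serves the ball of radius `a` around `φs`, and `c' / M` its complement
  refine ⟨min (c / b) (c' / M), by positivity, fun φ hφ => ?_⟩
  have h0 : 0 ≤ HMM.loss φs φ := by
    unfold HMM.loss
    positivity
  rcases lt_or_ge ‖φs - φ‖ a with h | h
  · obtain ⟨h1, h2⟩ := hball (y := φ) (by rwa [dist_comm, dist_eq_norm])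
    rw [Real.norm_of_nonneg h0, Real.norm_of_nonneg (by positivity)] at h2
    calc min (c / b) (c' / M) * HMM.loss φs φ ≤ c / b * (b * ‖φ - φs‖ ^ 2) :=
          mul_le_mul (min_le_left _ _) h2 h0 (by positivity)
      _ = c * ‖φ - φs‖ ^ 2 := by field_simp
      _ ≤ _ := h1
  · calc min (c / b) (c' / M) * HMM.loss φs φ ≤ c' / M * M :=
          mul_le_mul (min_le_right _ _) (hle φs (hΦ_sub hφs) φ (hΦ_sub hφ)) h0 (by positivity)
      _ = c' := by field_simp
      _ ≤ _ := hfar φ hφ h
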